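/- Consider the untyped call-by-value $\lambda$-calculus with shift and reset, with terms $t ::= x \mid \lambda x.t \mid t\,t \mid \mathcal{S}k.t \mid \langle t\rangle$ (up to $\alpha$-conversion; $\lambda x$ and $\mathcal{S}k$ are binders), values $v ::= \lambda x.t \mid x$, pure contexts $E ::= \square \mid v\,E \mid E\,t$ and evaluation contexts $F ::= \square \mid v\,F \mid F\,t \mid \langle F\rangle$. Reduction is given by $F[(\lambda x.t)\,v] \to F[t\{v/x\}]$, by $F[\langle E[\mathcal{S}k.t]\rangle] \to F[\langle t\{\lambda x.\langle E[x]\rangle/k\}\rangle]$ with $x\notin \mathrm{fv}(E)$, and by $F[\langle v\rangle] \to F[v]$; we write $t \Downarrow t'$ if $t \to^* t'$ and $t' \not\to$. Let $x \star y = x\,y$ and $(\lambda x.t)\star y = t\{y/x\}$. A relation $R$ on terms is extended to evaluation contexts as follows: $F_0 \mathrel{R} F_1$ if either $F_i = F_i'[\langle E_i\rangle]$ ($i=0,1$) with $E_i$ pure, $F_0'[x] \mathrel R F_1'[x]$ and $\langle E_0[x]\rangle \mathrel R \langle E_1[x]\rangle$ for a fresh $x$, or both $F_0$, $F_1$ are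 pure and $F_0[x] \mathrel R F_1[x]$ for a fresh $x$. The relation $R^{\mathrm{nf}}$ is defined inductively by: $v_0 \mathrel{R^{\mathrm{nf}}} v_1$ if $v_0\star x \mathrel R v_1 \star x$ for a fresh $x$; $F_0[x\,v_0] \mathrel{R^{\mathrm{nf}}} F_1[x\,v_1]$ if $F_0 \mathrel R F_1$ and $v_0 \mathrel{R^{\mathrm{nf}}} v_1$; and $E_0[\mathcal{S}k.t_0] \mathrel{R^{\mathrm{nf}}} E_1[\mathcal{S}k.t_1]$ if $E_0 \mathrel R E_1$ and $\langle t_0\rangle \mathrel R \langle t_1\rangle$. The relation $R^{\mathrm{rnf}}$ is defined in the same way, except that the last rule becomes: $E_0[\mathcal{S}k.t_0] \mathrel{R^{\mathrm{rnf}}} E_1[\mathcal{S}k.t_1]$ if $\langle t_0\{\lambda x.\langle k'\,E_0[x]\rangle/k\}\rangle \mathrel R \langle t_1\{\lambda x.\langle k'\,E_1[x]\rangle/k\}\rangle$ for distinct fresh $k'$, $x$. A relation $R$ is a normal form simulation if $t_0 \mathrel R t_1$ and $t_0 \Downarrow t_0'$ imply $t_1\Downarrow t_1'$ for some $t_1'$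 with $t_0' \mathrel{R^{\mathrm{nf}}} t_1'$; it is a normal form bisimulation if $R$ and $R^{-1}$ are normal form simulations. Normal form bisimilarity $\approx$ is the largest normal form bisimulation, and refined normal form bisimilarity $\approx_r$ is obtained in the same way from $R^{\mathrm{rnf}}$. Then for every pure context $E$, every term $t$ and all variables $k$, $k'$, $x$ such that $k' \notin \mathrm{fv}(E)\cup\mathrm{fv}(t)$, $x\notin\mathrm{fv}(E)$ and $x \neq k'$, $$E[\mathcal{S}k.t] \approx_r \mathcal{S}k'.\,t\{\lambda x.\langle k'\,E[x]\rangle/k\}.$$ This fails for plain bisimilarity: if $\Omega = (\lambda x.x\,x)\,(\lambda x.x\,x)$ and $E = (\lambda z.\Omega)\,\square$, then for every term $t$ and all variables $k$, $k'$, $x$ with $k'\notin\mathrm{fv}(t)$ and $x\neq k'$, $$E[\mathcal{S}k.t] \not\approx \mathcal{S}k'.\,t\{\lambda x.\langle k'\,E[x]\rangle/k\}.$$ -/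

import Mathlib

/-!
The untyped call-by-value lambda-calculus with the delimited-control operators shift and reset,
its normal form bisimilarity and its refined normal form bisimilarity.

Term variables are natural numbers. Terms are taken up to alpha-conversion by representing bound
variables with de Bruijn indices: under `d` binders the indices below `d` are bound, and the index
`n + d` is the free variable named `n`. The operations `Tm.Lam x t` and `Tm.Shift k t` build the
named abstractions `λx.t` and `Sk.t`.
-/

namespace ShiftReset

/-- Terms up to alpha-conversion. `lam` and `shift` bind the index `0` of their argument. -/
inductive Tm : Type
  | var (n : ℕ) : Tm
  | lam (b : Tm) : Tm
  | app (t u : Tm) : Tm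
  | shift (b : Tm) : Tm
  | reset (t : Tm) : Tm

namespace Tm

/-- The set of (names of) free variables. -/
def fv : Tm → Set ℕ
  | var n => {n}
  | lam b => {n | n + 1 ∈ b.fv}
  | app t u => t.fv ∪ u.fv
  | shift b => {n | n + 1 ∈ b.fv}
  | reset t => t.fv

/-- Extension of a renaming under a binder. -/
def upRen (ξ : ℕ → ℕ) : ℕ → ℕ
  | 0 => 0
  | n + 1 => ξ n + 1

/-- Capture-avoiding renaming of the free variables. -/
def rename (ξ : ℕ → ℕ) : Tm → Tm
  | var n => var (ξ n)
  | lam b => lam (b.rename (upRen ξ))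
  | app t u => app (t.rename ξ) (u.rename ξ)
  | shift b => shift (b.rename (upRen ξ))
  | reset t => reset (t.rename ξ)

/-- Extension of a substitution under a binder. -/
def up (σ : ℕ → Tm) : ℕ → Tm
  | 0 => var 0
  | n + 1 => (σ n).rename Nat.succ

/-- Capture-avoiding simultaneous substitution. -/
def bind (σ : ℕ → Tm) : Tm → Tm
  | var n => σ n
  | lam b => lam (b.bind (up σ))
  | app t u => app (t.bind σ) (u.bind σ)
  | shift b => shift (b.bind (up σ))
  | reset t => reset (t.bind σ)

/-- Capture-avoiding substitution `t{u/x}` of `u` for the free variable `x` in `t`. -/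
def subst (t : Tm) (x : ℕ) (u : Tm) : Tm :=
  t.bind (fun n => if n = x then u else var n)

/-- Instantiation of the bound variable of a body: if `λx.t` is `lam b`, or if `Sx.t` is `shift b`,
then `b.inst u` is `t{u/x}`. -/
def inst (b u : Tm) : Tm :=
  b.bind (fun n => match n with
    | 0 => u
    | m + 1 => var m)

/-- The body obtained from `t` by binding the free variable `x`. -/
def abstr (x : ℕ) (t : Tm) : Tm :=
  t.rename (fun n => if n = x then 0 else n + 1)

/-- The named abstraction `λx.t`. -/
def Lam (x : ℕ) (t : Tm) : Tm := lam (abstr x t)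

/-- The named control operator `Sk.t`. -/
def Shift (k : ℕ) (t : Tm) : Tm := shift (abstr k t)

/-- The diverging term `Ω = (λx.x x) (λx.x x)`. -/
def Omega : Tm :=
  app (Lam 0 (app (var 0) (var 0))) (Lam 0 (app (var 0) (var 0)))

end Tm

/-- Values: variables and abstractions. -/
inductive Value : Type
  | var (n : ℕ) : Value
  | lam (b : Tm) : Value

/-- A value as a term. -/
def Value.toTm : Value → Tm
  | .var n => .var n
  | .lam b => .lam b

/-- The application of a value to a variable: it is `x y` on a variable `x`, and `t{y/x}` on an
abstraction `λx.t`. -/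
def Value.appVal : Value → ℕ → Tm
  | .var x, y => .app (.var x) (.var y)
  | .lam b, y => b.inst (.var y)

/-- Call-by-value evaluation contexts `F ::= □ | v F | F t | ⟨F⟩`. -/
inductive EvalCtx : Type
  | hole : EvalCtx
  | appR (v : Value) (F : EvalCtx) : EvalCtx
  | appL (F : EvalCtx) (t : Tm) : EvalCtx
  | reset (F : EvalCtx) : EvalCtx

namespace EvalCtx

/-- Pure contexts `E ::= □ | v E | E t`: no reset encloses the hole. -/
def IsPure : EvalCtx → Prop
  | hole => True
  | appR _ F => F.IsPure
  | appL F _ => F.IsPure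
  | reset _ => False

/-- Filling a context with a term. -/
def fill : EvalCtx → Tm → Tm
  | hole, t => t
  | appR v F, t => .app v.toTm (F.fill t)
  | appL F u, t => .app (F.fill t) u
  | reset F, t => .reset (F.fill t)

/-- Filling a context with a context. -/
def comp : EvalCtx → EvalCtx → EvalCtx
  | hole, G => G
  | appR v F, G => appR v (F.comp G)
  | appL F u, G => appL (F.comp G) u
  | reset F, G => reset (F.comp G)

/-- The set of free variables of a context. -/
def fv : EvalCtx → Set ℕ
  | hole => ∅
  | appR v F => v.toTm.fv ∪ F.fv
  | appL F t => F.fv ∪ t.fv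
  | reset F => F.fv

end EvalCtx

open Tm

/-- One-step call-by-value reduction. -/
inductive Red : Tm → Tm → Prop
  | beta (F : EvalCtx) (b : Tm) (v : Value) :
      Red (F.fill (.app (.lam b) v.toTm)) (F.fill (b.inst v.toTm))
  | shift (F E : EvalCtx) (hE : E.IsPure) (b : Tm) (x : ℕ) (hx : x ∉ E.fv) :
      Red (F.fill (.reset (E.fill (.shift b))))
        (F.fill (.reset (b.inst (Lam x (.reset (E.fill (.var x)))))))
  | reset (F : EvalCtx) (v : Value) :
      Red (F.fill (.reset v.toTm)) (F.fill v.toTm)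

/-- Evaluation: `t` reduces in zero or more steps to `t'`, which does not reduce. -/
def Eval (t t' : Tm) : Prop :=
  Relation.ReflTransGen Red t t' ∧ ∀ u, ¬ Red t' u

/-- Extension of a relation on terms to evaluation contexts. -/
inductive CtxRel (R : Tm → Tm → Prop) : EvalCtx → EvalCtx → Prop
  | delim (F₀ F₁ E₀ E₁ : EvalCtx) (h₀ : E₀.IsPure) (h₁ : E₁.IsPure) (x : ℕ)
      (hx : x ∉ F₀.fv ∪ F₁.fv ∪ E₀.fv ∪ E₁.fv)
      (hF : R (F₀.fill (.var x)) (F₁.fill (.var x)))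
      (hE : R (.reset (E₀.fill (.var x))) (.reset (E₁.fill (.var x)))) :
      CtxRel R (F₀.comp (.reset E₀)) (F₁.comp (.reset E₁))
  | pure (E₀ E₁ : EvalCtx) (h₀ : E₀.IsPure) (h₁ : E₁.IsPure) (x : ℕ)
      (hx : x ∉ E₀.fv ∪ E₁.fv)
      (hE : R (E₀.fill (.var x)) (E₁.fill (.var x))) :
      CtxRel R E₀ E₁

/-- The relation on normal forms induced by a relation on terms. -/
inductive NF (R : Tm → Tm → Prop) : Tm → Tm → Prop
  | value (v₀ v₁ : Value) (x : ℕ) (hx : x ∉ v₀.toTm.fv ∪ v₁.toTm.fv)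
      (h : R (v₀.appVal x) (v₁.appVal x)) :
      NF R v₀.toTm v₁.toTm
  | control (E₀ E₁ : EvalCtx) (h₀ : E₀.IsPure) (h₁ : E₁.IsPure) (k : ℕ) (t₀ t₁ : Tm)
      (hE : CtxRel R E₀ E₁) (ht : R (.reset t₀) (.reset t₁)) :
      NF R (E₀.fill (Shift k t₀)) (E₁.fill (Shift k t₁))
  | openStuck (F₀ F₁ : EvalCtx) (x : ℕ) (v₀ v₁ : Value)
      (hF : CtxRel R F₀ F₁) (hv : NF R v₀.toTm v₁.toTm) :
      NF R (F₀.fill (.app (.var x) v₀.toTm)) (F₁.fill (.app (.var x) v₁.toTm))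

/-- The refined relation on normal forms induced by a relation on terms: it differs from `NF` on
control stuck terms only. -/
inductive RNF (R : Tm → Tm → Prop) : Tm → Tm → Prop
  | value (v₀ v₁ : Value) (x : ℕ) (hx : x ∉ v₀.toTm.fv ∪ v₁.toTm.fv)
      (h : R (v₀.appVal x) (v₁.appVal x)) :
      RNF R v₀.toTm v₁.toTm
  | control (E₀ E₁ : EvalCtx) (h₀ : E₀.IsPure) (h₁ : E₁.IsPure) (k : ℕ) (t₀ t₁ : Tm)
      (k' x : ℕ) (hk' : k' ∉ E₀.fv ∪ E₁.fv ∪ t₀.fv ∪ t₁.fv)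
      (hx : x ∉ E₀.fv ∪ E₁.fv ∪ t₀.fv ∪ t₁.fv) (hxk' : x ≠ k')
      (h : R (.reset (t₀.subst k (Lam x (.reset (.app (.var k') (E₀.fill (.var x)))))))
        (.reset (t₁.subst k (Lam x (.reset (.app (.var k') (E₁.fill (.var x)))))))) :
      RNF R (E₀.fill (Shift k t₀)) (E₁.fill (Shift k t₁))
  | openStuck (F₀ F₁ : EvalCtx) (x : ℕ) (v₀ v₁ : Value)
      (hF : CtxRel R F₀ F₁) (hv : RNF R v₀.toTm v₁.toTm) :
      RNF R (F₀.fill (.app (.var x) v₀.toTm)) (F₁.fill (.app (.var x) v₁.toTm))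

/-- Normal form simulations. -/
def IsSimulation (R : Tm → Tm → Prop) : Prop :=
  ∀ t₀ t₁ t₀', R t₀ t₁ → Eval t₀ t₀' → ∃ t₁', Eval t₁ t₁' ∧ NF R t₀' t₁'

/-- Normal form bisimulations: the relation and its inverse are simulations. -/
def IsBisimulation (R : Tm → Tm → Prop) : Prop :=
  IsSimulation R ∧ IsSimulation (flip R)

/-- Normal form bisimilarity: the union of all normal form bisimulations. -/
def Bisim (t₀ t₁ : Tm) : Prop :=
  ∃ R : Tm → Tm → Prop, IsBisimulation R ∧ R t₀ t₁

/-- Refined normal form simulations. -/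
def IsRefinedSimulation (R : Tm → Tm → Prop) : Prop :=
  ∀ t₀ t₁ t₀', R t₀ t₁ → Eval t₀ t₀' → ∃ t₁', Eval t₁ t₁' ∧ RNF R t₀' t₁'

/-- Refined normal form bisimulations: the relation and its inverse are refined simulations. -/
def IsRefinedBisimulation (R : Tm → Tm → Prop) : Prop :=
  IsRefinedSimulation R ∧ IsRefinedSimulation (flip R)

/-- Refined normal form bisimilarity: the union of all refined normal form bisimulations. -/
def RBisim (t₀ t₁ : Tm) : Prop :=
  ∃ R : Tm → Tm → Prop, IsRefinedBisimulation R ∧ R t₀ t₁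

end ShiftReset

/-!
For a fresh variable `j`, the refined rule for control stuck terms compares
`⟨t{λx.⟨j E[x]⟩/k}⟩` with `⟨t{λx.⟨(λy.⟨j y⟩) E[x]⟩/k}⟩`. The two sides differ only by the expansion
of some `⟨j u⟩` into `⟨(λy.⟨j y⟩) u⟩`. Terms that differ in this way reduce in lockstep until the
left-hand side is stuck at `F[⟨j v⟩]`; there the right-hand side takes one more step, to
`F'[⟨⟨j v'⟩⟩]`. The additional reset disappears by reduction as soon as the hole is filled with a
variable, so these pairs form a refined bisimulation up to reduction on the right-hand side.

The rule for plain bisimilarity compares the contexts themselves, and would demand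
`(λz.Ω) x ≈ x` for some `x`; but the left-hand side diverges.
-/

namespace ShiftReset

namespace Tm

theorem upRen_comp_upRen (ζ ξ : ℕ → ℕ) : upRen ζ ∘ upRen ξ = upRen (ζ ∘ ξ) := by
  funext n; cases n <;> rfl

theorem up_comp_upRen (σ : ℕ → Tm) (ξ : ℕ → ℕ) : up σ ∘ upRen ξ = up (σ ∘ ξ) := by
  funext n; cases n <;> rfl

theorem up_var_comp (ξ : ℕ → ℕ) : up (var ∘ ξ) = var ∘ upRen ξ := by
  funext n; cases n <;> rfl

theorem rename_rename (t : Tm) (ξ ζ : ℕ → ℕ) : (t.rename ξ).rename ζ = t.rename (ζ ∘ ξ) := by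
  induction t generalizing ξ ζ <;> simp_all [rename, upRen_comp_upRen]

theorem bind_rename (t : Tm) (ξ : ℕ → ℕ) (σ : ℕ → Tm) :
    (t.rename ξ).bind σ = t.bind (σ ∘ ξ) := by
  induction t generalizing ξ σ <;> simp_all [rename, bind, up_comp_upRen]

theorem rename_eq_bind (t : Tm) (ξ : ℕ → ℕ) : t.rename ξ = t.bind (var ∘ ξ) := by
  induction t generalizing ξ <;> simp_all [rename, bind, up_var_comp]

theorem up_rename (σ : ℕ → Tm) (ξ : ℕ → ℕ) :
    (fun n ↦ (up σ n).rename (upRen ξ)) = up fun n ↦ (σ n).rename ξ := by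
  funext n
  cases n with
  | zero => rfl
  | succ n => simp only [up, rename_rename]; rfl

theorem rename_bind (t : Tm) (σ : ℕ → Tm) (ξ : ℕ → ℕ) :
    (t.bind σ).rename ξ = t.bind fun n ↦ (σ n).rename ξ := by
  induction t generalizing σ ξ <;> simp_all [rename, bind, up_rename]

theorem up_bind (σ τ : ℕ → Tm) :
    (fun n ↦ (up σ n).bind (up τ)) = up fun n ↦ (σ n).bind τ := by
  funext n
  cases n with
  | zero => rfl
  | succ n => simp only [up, bind_rename, rename_bind]; rfl

theorem bind_bind (t : Tm) (σ τ : ℕ → Tm) :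
    (t.bind σ).bind τ = t.bind fun n ↦ (σ n).bind τ := by
  induction t generalizing σ τ <;> simp_all [bind, up_bind]

theorem eqOn_up {σ τ : ℕ → Tm} {s : Set ℕ} (h : Set.EqOn σ τ {n | n + 1 ∈ s}) :
    Set.EqOn (up σ) (up τ) s := by
  intro n hn
  cases n with
  | zero => rfl
  | succ n => simp only [up, h hn]

theorem bind_congr {t : Tm} {σ τ : ℕ → Tm} (h : Set.EqOn σ τ t.fv) : t.bind σ = t.bind τ := by
  induction t generalizing σ τ with
  | var n => exact h rfl
  | lam b ih => exact congrArg lam (ih (eqOn_up h))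
  | app t u iht ihu =>
    exact congrArg₂ app (iht (h.mono Set.subset_union_left)) (ihu (h.mono Set.subset_union_right))
  | shift b ih => exact congrArg shift (ih (eqOn_up h))
  | reset t ih => exact congrArg reset (ih h)

theorem bind_var (t : Tm) : t.bind var = t := by
  have up_var : up var = var := by funext n; cases n <;> rfl
  induction t <;> simp_all [bind]

theorem bind_eq_self {t : Tm} {σ : ℕ → Tm} (h : Set.EqOn σ var t.fv) : t.bind σ = t :=
  (bind_congr h).trans t.bind_var

theorem fv_rename (t : Tm) (ξ : ℕ → ℕ) : (t.rename ξ).fv = ξ '' t.fv := by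
  have under_binder (s : Set ℕ) (ξ : ℕ → ℕ) :
      {n | n + 1 ∈ upRen ξ '' s} = ξ '' {n | n + 1 ∈ s} := by
    ext n
    constructor
    · rintro ⟨_ | m, hm, e⟩
      · cases e
      · exact ⟨m, hm, Nat.succ_injective e⟩
    · rintro ⟨m, hm, rfl⟩
      exact ⟨m + 1, hm, rfl⟩
  induction t generalizing ξ <;> simp_all [rename, fv, Set.image_union]

theorem mem_fv_bind {t : Tm} {σ : ℕ → Tm} {n : ℕ} :
    n ∈ (t.bind σ).fv ↔ ∃ m ∈ t.fv, n ∈ (σ m).fv := by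
  have under_binder {s : Set ℕ} {σ : ℕ → Tm} {n : ℕ} :
      (∃ m ∈ s, n + 1 ∈ (up σ m).fv) ↔ ∃ m, m + 1 ∈ s ∧ n ∈ (σ m).fv := by
    constructor
    · rintro ⟨_ | m, hm, hn⟩
      · cases hn
      · exact ⟨m, hm, by simpa [up, fv_rename] using hn⟩
    · rintro ⟨m, hm, hn⟩
      exact ⟨m + 1, hm, by simpa [up, fv_rename] using hn⟩
  induction t generalizing σ n with
  | var m => simp [bind, fv]
  | app t u iht ihu => simp [bind, fv, iht, ihu, or_and_right, exists_or]
  | reset _ ih => exact ih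
  | lam b ih | shift b ih => exact ih.trans under_binder

theorem fv_finite (t : Tm) : t.fv.Finite := by
  induction t with
  | var n => exact Set.finite_singleton n
  | app t u iht ihu => exact iht.union ihu
  | reset _ ih => exact ih
  | lam b ih | shift b ih => exact ih.preimage Nat.succ_injective.injOn

theorem fv_inst_var_subset (b : Tm) (x : ℕ) : (b.inst (var x)).fv ⊆ insert x (shift b).fv := by
  intro n hn
  obtain ⟨_ | m, hm, hnm⟩ := mem_fv_bind.1 hn
  · exact Or.inl hnm
  · obtain rfl : n = m := hnm
    exact Or.inr hm

theorem fv_Lam (x : ℕ) (t : Tm) : (Lam x t).fv = t.fv \ {x} := by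
  ext n
  simp only [Lam, abstr, fv, fv_rename]
  constructor
  · rintro ⟨m, hm, e⟩
    dsimp only at e
    split_ifs at e with hmx
    obtain rfl := Nat.succ_injective e
    exact ⟨hm, hmx⟩
  · rintro ⟨hn, hnx⟩
    exact ⟨n, hn, if_neg hnx⟩

theorem abstr_inst (x : ℕ) (t u : Tm) : (abstr x t).inst u = t.subst x u := by
  rw [abstr, inst, bind_rename, subst]
  congr 1
  funext n
  by_cases h : n = x <;> simp [h]

theorem abstr_of_notMem {x : ℕ} {t : Tm} (hx : x ∉ t.fv) : abstr x t = t.rename Nat.succ := by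
  rw [abstr, rename_eq_bind, rename_eq_bind]
  refine bind_congr fun n hn ↦ ?_
  simp [ne_of_mem_of_not_mem hn hx]

theorem abstr_inst_var {x : ℕ} {b : Tm} (hx : x ∉ (shift b).fv) : abstr x (b.inst (var x)) = b := by
  rw [abstr, inst, rename_bind]
  refine bind_eq_self fun n hn ↦ ?_
  cases n with
  | zero => simp [rename]
  | succ n => simp [rename, ne_of_mem_of_not_mem (show n ∈ (shift b).fv from hn) hx]

theorem inst_var_subst {x : ℕ} {b : Tm} (hx : x ∉ (shift b).fv) (u : Tm) :
    (b.inst (var x)).subst x u = b.inst u := by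
  rw [← abstr_inst, abstr_inst_var hx]

theorem subst_of_notMem {x : ℕ} {t : Tm} (hx : x ∉ t.fv) (u : Tm) : t.subst x u = t :=
  bind_eq_self fun _ hn ↦ if_neg (ne_of_mem_of_not_mem hn hx)

theorem subst_subst_of_notMem {y : ℕ} {t : Tm} (hy : y ∉ t.fv) (x : ℕ) (u w : Tm) :
    (t.subst x u).subst y w = t.subst x (u.subst y w) := by
  rw [subst, subst, bind_bind]
  refine bind_congr fun n hn ↦ ?_
  by_cases hnx : n = x
  · simp [hnx, subst]
  · simp [hnx, bind, ne_of_mem_of_not_mem hn hy]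

end Tm

open Tm

/-- Renaming of the free variables of a value. -/
def Value.rename (ξ : ℕ → ℕ) : Value → Value
  | .var n => .var (ξ n)
  | .lam b => .lam (b.rename (upRen ξ))

theorem Value.toTm_rename (ξ : ℕ → ℕ) (v : Value) : (v.rename ξ).toTm = v.toTm.rename ξ := by
  cases v <;> rfl

namespace EvalCtx

/-- Renaming of the free variables of a context. -/
def rename (ξ : ℕ → ℕ) : EvalCtx → EvalCtx
  | hole => hole
  | appR v F => appR (v.rename ξ) (F.rename ξ)
  | appL F t => appL (F.rename ξ) (t.rename ξ)
  | reset F => reset (F.rename ξ)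

theorem fv_fill (F : EvalCtx) (t : Tm) : (F.fill t).fv = F.fv ∪ t.fv := by
  induction F with
  | hole => exact (Set.empty_union _).symm
  | appR v F ih => simp only [fill, fv, Tm.fv, ih, Set.union_assoc]
  | appL F u ih => simp only [fill, fv, Tm.fv, ih, Set.union_right_comm]
  | reset _ ih => exact ih

theorem fv_finite (F : EvalCtx) : F.fv.Finite :=
  (F.fill (.var 0)).fv_finite.subset (F.fv_fill _ ▸ Set.subset_union_left)

theorem fill_comp (F G : EvalCtx) (t : Tm) : (F.comp G).fill t = F.fill (G.fill t) := by
  induction F <;> simp_all [fill, comp]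

theorem not_isPure_comp_reset (F E : EvalCtx) : ¬ (F.comp (reset E)).IsPure := by
  induction F <;> simp_all [comp, IsPure]

theorem abstr_fill_var {F : EvalCtx} {x : ℕ} (hx : x ∉ F.fv) :
    abstr x (F.fill (.var x)) = (F.rename Nat.succ).fill (.var 0) := by
  induction F with
  | hole => simp [abstr, fill, Tm.rename, rename]
  | appR v F ih =>
    obtain ⟨hv, hF⟩ := not_or.1 hx
    exact congrArg₂ Tm.app ((abstr_of_notMem hv).trans (v.toTm_rename _).symm) (ih hF)
  | appL F t ih =>
    obtain ⟨hF, ht⟩ := not_or.1 hx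
    exact congrArg₂ Tm.app (ih hF) (abstr_of_notMem ht)
  | reset F ih => exact congrArg Tm.reset (ih hx)

/-- The continuation `λx.⟨E[x]⟩` captured by a control operator in the context `E`. -/
def cont (E : EvalCtx) : Value := .lam (.reset ((E.rename Nat.succ).fill (.var 0)))

theorem Lam_reset_fill_var {E : EvalCtx} {x : ℕ} (hx : x ∉ E.fv) :
    Lam x (.reset (E.fill (.var x))) = E.cont.toTm :=
  congrArg (fun t ↦ Tm.lam (.reset t)) (abstr_fill_var hx)

theorem Lam_reset_app_var_fill_var {E : EvalCtx} {k x : ℕ} (hx : x ∉ E.fv) (hxk : x ≠ k) :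
    Lam x (.reset (.app (.var k) (E.fill (.var x)))) = (appR (.var k) E).cont.toTm :=
  Lam_reset_fill_var (E := appR (.var k) E) (not_or.2 ⟨hxk, hx⟩)

theorem fv_toTm_cont (E : EvalCtx) : E.cont.toTm.fv = E.fv := by
  obtain ⟨x, hx⟩ := E.fv_finite.exists_notMem
  rw [← Lam_reset_fill_var hx, fv_Lam, Tm.fv, fv_fill, Tm.fv, Set.union_sdiff_right,
    Set.sdiff_singleton_eq_self hx]

theorem subst_cont_appR_var {E : EvalCtx} {k : ℕ} (hk : k ∉ E.fv) (v : Value) :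
    (appR (.var k) E).cont.toTm.subst k v.toTm = (appR v E).cont.toTm := by
  have hE : E.cont.toTm.subst k v.toTm = E.cont.toTm :=
    subst_of_notMem (E.fv_toTm_cont.symm ▸ hk) _
  injection hE with hE
  injection hE with hE
  refine congrArg (fun t ↦ Tm.lam (.reset t)) (congrArg₂ Tm.app ?_ hE)
  change Tm.rename Nat.succ (if k = k then v.toTm else _) = (v.rename Nat.succ).toTm
  rw [if_pos rfl, Value.toTm_rename]

end EvalCtx

/-! ### Decomposition and evaluation -/

/-- What a term decomposes into: a value, an open stuck term `F[x v]`, a control stuck term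
`E[Sk.b]`, or a redex in an evaluation context, in which case only the reduct is recorded. -/
inductive Decomp : Type
  | value (v : Value) : Decomp
  | openStuck (F : EvalCtx) (x : ℕ) (v : Value) : Decomp
  | controlStuck (E : EvalCtx) (b : Tm) : Decomp
  | step (t : Tm) : Decomp

namespace Decomp

/-- The decomposition of `⟨t⟩` from that of `t`. -/
def reset : Decomp → Decomp
  | value v => step v.toTm
  | openStuck F x v => openStuck (.reset F) x v
  | controlStuck E b => step (.reset (b.inst E.cont.toTm))
  | step t => step (.reset t)

/-- The decomposition of `v u` from that of `u`. -/
def appR (v : Value) : Decomp → Decomp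
  | value w =>
    match v with
    | .var x => openStuck .hole x w
    | .lam b => step (b.inst w.toTm)
  | openStuck F x w => openStuck (.appR v F) x w
  | controlStuck E b => controlStuck (.appR v E) b
  | step u => step (.app v.toTm u)

/-- The decomposition of `t u` from the decompositions `d` of `t` and `e` of `u`. -/
def app (d : Decomp) (u : Tm) (e : Decomp) : Decomp :=
  match d with
  | value v => e.appR v
  | openStuck F x v => openStuck (.appL F u) x v
  | controlStuck E b => controlStuck (.appL E u) b
  | step t => step (.app t u)

end Decomp

/-- The decomposition of a term. -/
def Tm.decomp : Tm → Decomp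
  | .var n => .value (.var n)
  | .lam b => .value (.lam b)
  | .app t u => t.decomp.app u u.decomp
  | .shift b => .controlStuck .hole b
  | .reset t => t.decomp.reset

/-- `HasDecomp t d` says that the shape recorded by `d` is really that of `t`. -/
inductive HasDecomp : Tm → Decomp → Prop
  | value (v : Value) : HasDecomp v.toTm (.value v)
  | openStuck (F : EvalCtx) (x : ℕ) (v : Value) :
      HasDecomp (F.fill (.app (.var x) v.toTm)) (.openStuck F x v)
  | controlStuck {E : EvalCtx} (hE : E.IsPure) (b : Tm) :
      HasDecomp (E.fill (.shift b)) (.controlStuck E b)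
  | step {t t' : Tm} (h : Red t t') : HasDecomp t (.step t')

theorem Red.fill {t t' : Tm} (h : Red t t') (F : EvalCtx) : Red (F.fill t) (F.fill t') := by
  cases h with
  | beta G b v => simpa only [EvalCtx.fill_comp] using Red.beta (F.comp G) b v
  | shift G E hE b x hx => simpa only [EvalCtx.fill_comp] using Red.shift (F.comp G) E hE b x hx
  | reset G v => simpa only [EvalCtx.fill_comp] using Red.reset (F.comp G) v

theorem Red.reset_fill_shift {E : EvalCtx} (hE : E.IsPure) (b : Tm) :
    Red (.reset (E.fill (.shift b))) (.reset (b.inst E.cont.toTm)) := by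
  obtain ⟨x, hx⟩ := E.fv_finite.exists_notMem
  exact EvalCtx.Lam_reset_fill_var hx ▸ Red.shift .hole E hE b x hx

namespace HasDecomp

theorem reset {t : Tm} {d : Decomp} (h : HasDecomp t d) : HasDecomp (.reset t) d.reset := by
  cases h with
  | value v => exact .step (.reset .hole v)
  | openStuck F x v => exact .openStuck (.reset F) x v
  | controlStuck hE b => exact .step (.reset_fill_shift hE b)
  | step h => exact .step (h.fill (.reset .hole))

theorem appR (v : Value) {u : Tm} {e : Decomp} (h : HasDecomp u e) :
    HasDecomp (.app v.toTm u) (e.appR v) := by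
  cases h with
  | value w =>
    cases v with
    | var x => exact .openStuck .hole x w
    | lam b => exact .step (.beta .hole b w)
  | openStuck F x w => exact .openStuck (.appR v F) x w
  | controlStuck hE b => exact .controlStuck (E := .appR v _) hE b
  | step h => exact .step (h.fill (.appR v .hole))

theorem app {t u : Tm} {d e : Decomp} (ht : HasDecomp t d) (hu : HasDecomp u e) :
    HasDecomp (.app t u) (d.app u e) := by
  cases ht with
  | value v => exact hu.appR v
  | openStuck F x v => exact .openStuck (.appL F u) x v
  | controlStuck hE b => exact .controlStuck (E := .appL _ u) hE b
  | step h => exact .step (h.fill (.appL .hole u))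

end HasDecomp

theorem Tm.hasDecomp (t : Tm) : HasDecomp t t.decomp := by
  induction t with
  | var n => exact .value (.var n)
  | lam b => exact .value (.lam b)
  | app t u iht ihu => exact iht.app ihu
  | shift b => exact .controlStuck (E := .hole) trivial b
  | reset t ih => exact ih.reset

theorem decomp_toTm (v : Value) : v.toTm.decomp = .value v := by cases v <;> rfl

theorem decomp_fill_of_decomp_eq_step {t t' : Tm} (h : t.decomp = .step t') (F : EvalCtx) :
    (F.fill t).decomp = .step (F.fill t') := by
  induction F <;>
    simp_all [EvalCtx.fill, Tm.decomp, Decomp.app, Decomp.appR, Decomp.reset, decomp_toTm]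

theorem decomp_fill_shift {E : EvalCtx} (hE : E.IsPure) (b : Tm) :
    (E.fill (.shift b)).decomp = .controlStuck E b := by
  induction E <;>
    simp_all [EvalCtx.fill, Tm.decomp, Decomp.app, Decomp.appR, decomp_toTm, EvalCtx.IsPure]

theorem decomp_fill_app_var (F : EvalCtx) (x : ℕ) (v : Value) :
    (F.fill (.app (.var x) v.toTm)).decomp = .openStuck F x v := by
  induction F <;>
    simp_all [EvalCtx.fill, Tm.decomp, Decomp.app, Decomp.appR, Decomp.reset, decomp_toTm]

theorem HasDecomp.decomp_eq {t : Tm} {d : Decomp} (h : HasDecomp t d) : t.decomp = d := by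
  cases h with
  | value v => exact decomp_toTm v
  | openStuck F x v => exact decomp_fill_app_var F x v
  | controlStuck hE b => exact decomp_fill_shift hE b
  | step h =>
    cases h with
    | beta F b v =>
      refine decomp_fill_of_decomp_eq_step ?_ F
      simp only [Tm.decomp, decomp_toTm, Decomp.app, Decomp.appR]
    | shift F E hE b x hx =>
      refine decomp_fill_of_decomp_eq_step ?_ F
      rw [EvalCtx.Lam_reset_fill_var hx, Tm.decomp, decomp_fill_shift hE, Decomp.reset]
    | reset F v =>
      refine decomp_fill_of_decomp_eq_step ?_ F
      rw [Tm.decomp, decomp_toTm, Decomp.reset]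

theorem HasDecomp.unique {t : Tm} {d e : Decomp} (hd : HasDecomp t d) (he : HasDecomp t e) :
    d = e :=
  hd.decomp_eq.symm.trans he.decomp_eq

theorem Red.rightUnique : Relator.RightUnique Red := fun _ _ _ h h' ↦ by
  injection (HasDecomp.step h).unique (.step h')

/-- Terms that do not reduce: the condition on results in `Eval`. -/
def IsNormal (t : Tm) : Prop := ∀ u, ¬ Red t u

theorem isNormal_toTm (v : Value) : IsNormal v.toTm := fun _ h ↦ by
  cases (HasDecomp.value v).unique (.step h)

theorem isNormal_fill_app_var (F : EvalCtx) (x : ℕ) (v : Value) :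
    IsNormal (F.fill (.app (.var x) v.toTm)) := fun _ h ↦ by
  cases (HasDecomp.openStuck F x v).unique (.step h)

theorem isNormal_fill_shift {E : EvalCtx} (hE : E.IsPure) (b : Tm) :
    IsNormal (E.fill (.shift b)) := fun _ h ↦ by
  cases (HasDecomp.controlStuck hE b).unique (.step h)

theorem isNormal_Shift (k : ℕ) (t : Tm) : IsNormal (Shift k t) :=
  isNormal_fill_shift (E := .hole) trivial _

theorem IsNormal.eval {t : Tm} (h : IsNormal t) : Eval t t := ⟨.refl, h⟩

theorem IsNormal.eq_of_eval {t w : Tm} (h : IsNormal t) (hw : Eval t w) : w = t :=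
  (Relation.reflTransGen_iff_eq h).1 hw.1

theorem Eval.of_reds {t u w : Tm} (h : Relation.ReflTransGen Red t u) (hw : Eval u w) : Eval t w :=
  ⟨h.trans hw.1, hw.2⟩

theorem Eval.of_reds_left {t u w : Tm} (h : Relation.ReflTransGen Red t u) (hw : Eval t w) :
    Eval u w := by
  rcases Relation.ReflTransGen.total_of_right_unique Red.rightUnique h hw.1 with huw | hwu
  · exact ⟨huw, hw.2⟩
  · rw [(Relation.reflTransGen_iff_eq hw.2).1 hwu]
    exact IsNormal.eval hw.2

theorem Eval.unique {t u w : Tm} (hu : Eval t u) (hw : Eval t w) : w = u :=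
  IsNormal.eq_of_eval hu.2 (hw.of_reds_left hu.1)

/-! ### Reset expansion of a continuation variable -/

/-- The expansion `λy.⟨k y⟩` of a variable `k` that stands for a continuation. -/
def etaReset (k : ℕ) : Value := (EvalCtx.appR (.var k) .hole).cont

/-- The least compatible relation that replaces `⟨k t⟩` on the left by `⟨(λy.⟨k y⟩) t⟩` on the
right. The index `k` is incremented under binders. -/
inductive EtaRel : ℕ → Tm → Tm → Prop
  | var (k n : ℕ) : EtaRel k (.var n) (.var n)
  | lam {k : ℕ} {b b' : Tm} (h : EtaRel (k + 1) b b') : EtaRel k (.lam b) (.lam b')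
  | app {k : ℕ} {t t' u u' : Tm} (ht : EtaRel k t t') (hu : EtaRel k u u') :
      EtaRel k (.app t u) (.app t' u')
  | shift {k : ℕ} {b b' : Tm} (h : EtaRel (k + 1) b b') : EtaRel k (.shift b) (.shift b')
  | reset {k : ℕ} {t t' : Tm} (h : EtaRel k t t') : EtaRel k (.reset t) (.reset t')
  | eta {k : ℕ} {t t' : Tm} (h : EtaRel k t t') :
      EtaRel k (.reset (.app (.var k) t)) (.reset (.app (etaReset k).toTm t'))

namespace EtaRel

theorem rename {k : ℕ} {t t' : Tm} (h : EtaRel k t t') (ξ : ℕ → ℕ) :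
    EtaRel (ξ k) (t.rename ξ) (t'.rename ξ) := by
  induction h generalizing ξ with
  | var k n => exact .var _ _
  | lam _ ih => exact .lam (ih (upRen ξ))
  | app _ _ iht ihu => exact .app (iht ξ) (ihu ξ)
  | shift _ ih => exact .shift (ih (upRen ξ))
  | reset _ ih => exact .reset (ih ξ)
  | eta _ ih => exact .eta (ih ξ)

theorem up {k : ℕ} {σ σ' : ℕ → Tm} (h : ∀ n, EtaRel k (σ n) (σ' n)) (n : ℕ) :
    EtaRel (k + 1) (Tm.up σ n) (Tm.up σ' n) := by
  cases n with
  | zero => exact .var _ _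
  | succ n => exact (h n).rename Nat.succ

theorem bind_right {k : ℕ} (t : Tm) {σ σ' : ℕ → Tm} (h : ∀ n, EtaRel k (σ n) (σ' n)) :
    EtaRel k (t.bind σ) (t.bind σ') := by
  induction t generalizing k σ σ' with
  | var n => exact h n
  | lam b ih => exact .lam (ih (up h))
  | app t u iht ihu => exact .app (iht h) (ihu h)
  | shift b ih => exact .shift (ih (up h))
  | reset t ih => exact .reset (ih h)

theorem refl (k : ℕ) (t : Tm) : EtaRel k t t := by
  simpa only [bind_var] using bind_right t (EtaRel.var k)

theorem subst_right {k : ℕ} (t : Tm) (x : ℕ) {u u' : Tm} (h : EtaRel k u u') :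
    EtaRel k (t.subst x u) (t.subst x u') := by
  refine bind_right t fun n ↦ ?_
  split_ifs
  · exact h
  · exact .var k n

theorem bind {k j : ℕ} {t t' : Tm} (h : EtaRel k t t') {σ σ' : ℕ → Tm}
    (hσ : ∀ n, EtaRel j (σ n) (σ' n)) (hk : σ k = .var j) (hk' : σ' k = .var j) :
    EtaRel j (t.bind σ) (t'.bind σ') := by
  have up_eq {τ : ℕ → Tm} {k j : ℕ} (h : τ k = .var j) : Tm.up τ (k + 1) = .var (j + 1) :=
    congrArg (Tm.rename Nat.succ) h
  induction h generalizing j σ σ' with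
  | var k n => exact hσ n
  | lam _ ih => exact .lam (ih (up hσ) (up_eq hk) (up_eq hk'))
  | app _ _ iht ihu => exact .app (iht hσ hk hk') (ihu hσ hk hk')
  | shift _ ih => exact .shift (ih (up hσ) (up_eq hk) (up_eq hk'))
  | reset _ ih => exact .reset (ih hσ hk hk')
  | @eta k t t' _ ih =>
    have etaReset_bind : (etaReset k).toTm.bind σ' = (etaReset j).toTm :=
      congrArg (fun u ↦ Tm.lam (.reset (.app u (.var 0)))) (up_eq hk')
    simp only [Tm.bind, hk, etaReset_bind]
    exact .eta (ih hσ hk hk')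

theorem inst {k : ℕ} {b b' u u' : Tm} (hb : EtaRel (k + 1) b b') (hu : EtaRel k u u') :
    EtaRel k (b.inst u) (b'.inst u') := by
  refine hb.bind (fun n ↦ ?_) rfl rfl
  cases n with
  | zero => exact hu
  | succ n => exact .var k n

theorem appVal {k : ℕ} {v v' : Value} (h : EtaRel k v.toTm v'.toTm) (x : ℕ) :
    EtaRel k (v.appVal x) (v'.appVal x) := by
  cases v <;> cases v' <;> cases h
  · exact .refl k _
  · rename_i hb
    exact hb.inst (.var k x)

end EtaRel

/-- The extension of `EtaRel` to evaluation contexts. -/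
inductive EtaCtxRel (k : ℕ) : EvalCtx → EvalCtx → Prop
  | hole : EtaCtxRel k .hole .hole
  | appR {v v' : Value} {F F' : EvalCtx} (hv : EtaRel k v.toTm v'.toTm)
      (hF : EtaCtxRel k F F') : EtaCtxRel k (.appR v F) (.appR v' F')
  | appL {F F' : EvalCtx} {t t' : Tm} (hF : EtaCtxRel k F F') (ht : EtaRel k t t') :
      EtaCtxRel k (.appL F t) (.appL F' t')
  | reset {F F' : EvalCtx} (hF : EtaCtxRel k F F') : EtaCtxRel k (.reset F) (.reset F')
  | eta {F F' : EvalCtx} (hF : EtaCtxRel k F F') :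
      EtaCtxRel k (.reset (.appR (.var k) F)) (.reset (.appR (etaReset k) F'))

namespace EtaCtxRel

theorem fill {k : ℕ} {F F' : EvalCtx} (hF : EtaCtxRel k F F') {t t' : Tm} (ht : EtaRel k t t') :
    EtaRel k (F.fill t) (F'.fill t') := by
  induction hF with
  | hole => exact ht
  | appR hv _ ih => exact .app hv ih
  | appL _ hu ih => exact .app ih hu
  | reset _ ih => exact .reset ih
  | eta _ ih => exact .eta ih

theorem rename {k : ℕ} {F F' : EvalCtx} (h : EtaCtxRel k F F') (ξ : ℕ → ℕ) :
    EtaCtxRel (ξ k) (F.rename ξ) (F'.rename ξ) := by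
  induction h with
  | hole => exact .hole
  | appR hv _ ih => exact .appR (by simpa only [Value.toTm_rename] using hv.rename ξ) ih
  | appL _ hu ih => exact .appL ih (hu.rename ξ)
  | reset _ ih => exact .reset ih
  | eta _ ih => exact .eta ih

theorem cont {k : ℕ} {E E' : EvalCtx} (h : EtaCtxRel k E E') :
    EtaRel k E.cont.toTm E'.cont.toTm :=
  .lam (.reset ((h.rename Nat.succ).fill (.var _ _)))

theorem cont_eta {k : ℕ} {E E' : EvalCtx} (h : EtaCtxRel k E E') :
    EtaRel k (EvalCtx.appR (.var k) E).cont.toTm (EvalCtx.appR (etaReset k) E').cont.toTm :=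
  .lam (.eta ((h.rename Nat.succ).fill (.var _ _)))

theorem isPure_or_exists_comp_reset {k : ℕ} {F F' : EvalCtx} (h : EtaCtxRel k F F') :
    (F.IsPure ∧ F'.IsPure) ∨
    ∃ G G' E E' : EvalCtx, F = G.comp (.reset E) ∧ F' = G'.comp (.reset E') ∧
      E.IsPure ∧ E'.IsPure ∧ EtaCtxRel k G G' ∧ EtaCtxRel k (.reset E) (.reset E') := by
  induction h with
  | hole => exact .inl ⟨trivial, trivial⟩
  | appR hv _ ih =>
    rcases ih with hpure | ⟨G, G', E, E', rfl, rfl, hE, hE', hG, hR⟩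
    · exact .inl hpure
    · exact .inr ⟨.appR _ G, .appR _ G', E, E', rfl, rfl, hE, hE', .appR hv hG, hR⟩
  | appL _ hu ih =>
    rcases ih with hpure | ⟨G, G', E, E', rfl, rfl, hE, hE', hG, hR⟩
    · exact .inl hpure
    · exact .inr ⟨.appL G _, .appL G' _, E, E', rfl, rfl, hE, hE', .appL hG hu, hR⟩
  | reset hF ih =>
    rcases ih with ⟨hE, hE'⟩ | ⟨G, G', E, E', rfl, rfl, hE, hE', hG, hR⟩
    · exact .inr ⟨.hole, .hole, _, _, rfl, rfl, hE, hE', .hole, .reset hF⟩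
    · exact .inr ⟨.reset G, .reset G', E, E', rfl, rfl, hE, hE', .reset hG, hR⟩
  | eta hF ih =>
    rcases ih with ⟨hE, hE'⟩ | ⟨G, G', E, E', rfl, rfl, hE, hE', hG, hR⟩
    · exact .inr ⟨.hole, .hole, _, _, rfl, rfl, hE, hE', .hole, .eta hF⟩
    · exact .inr ⟨.reset (.appR _ G), .reset (.appR _ G'), E, E', rfl, rfl, hE, hE', .eta hG, hR⟩

end EtaCtxRel

/-- The correspondence between the decompositions of terms related by `EtaRel`. They have the same
shape unless the left-hand side is stuck at `⟨k v⟩`, as in `etaStuck`: there the right-hand side has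
one more step, `⟨(λy.⟨k y⟩) v'⟩ → ⟨⟨k v'⟩⟩`. -/
inductive EtaDecompRel (k : ℕ) : Decomp → Decomp → Prop
  | value {v v' : Value} (hv : EtaRel k v.toTm v'.toTm) : EtaDecompRel k (.value v) (.value v')
  | openStuck {F F' : EvalCtx} (x : ℕ) {v v' : Value} (hF : EtaCtxRel k F F')
      (hv : EtaRel k v.toTm v'.toTm) : EtaDecompRel k (.openStuck F x v) (.openStuck F' x v')
  | controlStuck {E E' : EvalCtx} {b b' : Tm} (hE : EtaCtxRel k E E') (hb : EtaRel (k + 1) b b') :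
      EtaDecompRel k (.controlStuck E b) (.controlStuck E' b')
  | step {t t' : Tm} (h : EtaRel k t t') : EtaDecompRel k (.step t) (.step t')
  | etaStuck {F F' : EvalCtx} {v v' : Value} (hF : EtaCtxRel k F F')
      (hv : EtaRel k v.toTm v'.toTm) :
      EtaDecompRel k (.openStuck (F.comp (.reset .hole)) k v)
        (.step (F'.fill (.reset (.reset (.app (.var k) v'.toTm)))))

namespace EtaDecompRel

theorem reset {k : ℕ} {d d' : Decomp} (h : EtaDecompRel k d d') :
    EtaDecompRel k d.reset d'.reset := by
  cases h with
  | value hv => exact .step hv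
  | openStuck x hF hv => exact .openStuck x (.reset hF) hv
  | controlStuck hE hb => exact .step (.reset (hb.inst hE.cont))
  | step h => exact .step (.reset h)
  | etaStuck hF hv => exact .etaStuck (.reset hF) hv

theorem eta {k : ℕ} {d d' : Decomp} (h : EtaDecompRel k d d') :
    EtaDecompRel k (d.appR (.var k)).reset (d'.appR (etaReset k)).reset := by
  cases h with
  | value hv => exact .etaStuck .hole hv
  | openStuck x hF hv => exact .openStuck x (.eta hF) hv
  | controlStuck hE hb => exact .step (.reset (hb.inst hE.cont_eta))
  | step h => exact .step (.eta h)
  | etaStuck hF hv => exact .etaStuck (.eta hF) hv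

theorem appR {k : ℕ} {v v' : Value} {e e' : Decomp} (hv : EtaRel k v.toTm v'.toTm)
    (he : EtaDecompRel k e e') : EtaDecompRel k (e.appR v) (e'.appR v') := by
  cases he with
  | value hw =>
    cases v <;> cases v' <;> cases hv
    · exact .openStuck _ .hole hw
    · rename_i hb
      exact .step (hb.inst hw)
  | openStuck x hF hw => exact .openStuck x (.appR hv hF) hw
  | controlStuck hE hb => exact .controlStuck (.appR hv hE) hb
  | step h => exact .step (.app hv h)
  | etaStuck hF hw => exact .etaStuck (.appR hv hF) hw

theorem app {k : ℕ} {u u' : Tm} {d d' e e' : Decomp} (hu : EtaRel k u u')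
    (hd : EtaDecompRel k d d') (he : EtaDecompRel k e e') :
    EtaDecompRel k (d.app u e) (d'.app u' e') := by
  cases hd with
  | value hv => exact he.appR hv
  | openStuck x hF hv => exact .openStuck x (.appL hF hu) hv
  | controlStuck hE hb => exact .controlStuck (.appL hE hu) hb
  | step h => exact .step (.app h hu)
  | etaStuck hF hv => exact .etaStuck (.appL hF hu) hv

end EtaDecompRel

theorem EtaRel.decomp {k : ℕ} {t t' : Tm} (h : EtaRel k t t') :
    EtaDecompRel k t.decomp t'.decomp := by
  induction h with
  | var k n => exact .value (v := .var n) (v' := .var n) (.var k n)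
  | lam h _ => exact .value (v := .lam _) (v' := .lam _) (.lam h)
  | app _ hu iht ihu => exact iht.app hu ihu
  | shift h _ => exact .controlStuck .hole h
  | reset _ ih => exact ih.reset
  | eta _ ih => exact ih.eta

/-! ### Refined bisimilarity -/

theorem CtxRel.mono {R S : Tm → Tm → Prop} (hRS : R ≤ S) {F F' : EvalCtx} (h : CtxRel R F F') :
    CtxRel S F F' := by
  cases h with
  | delim F₀ F₁ E₀ E₁ h₀ h₁ x hx hF hE =>
    exact .delim F₀ F₁ E₀ E₁ h₀ h₁ x hx (hRS _ _ hF) (hRS _ _ hE)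
  | pure _ _ h₀ h₁ x hx hE => exact .pure _ _ h₀ h₁ x hx (hRS _ _ hE)

theorem RNF.mono {R S : Tm → Tm → Prop} (hRS : R ≤ S) {t u : Tm} (h : RNF R t u) : RNF S t u := by
  induction h with
  | value v₀ v₁ x hx h => exact .value v₀ v₁ x hx (hRS _ _ h)
  | control E₀ E₁ h₀ h₁ k t₀ t₁ k' x hk' hx hxk' h =>
    exact .control E₀ E₁ h₀ h₁ k t₀ t₁ k' x hk' hx hxk' (hRS _ _ h)
  | openStuck F₀ F₁ x v₀ v₁ hF _ ih => exact .openStuck F₀ F₁ x v₀ v₁ (hF.mono hRS) ih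

theorem CtxRel.flip {R : Tm → Tm → Prop} {F F' : EvalCtx} (h : CtxRel R F F') :
    CtxRel (flip R) F' F := by
  cases h with
  | delim F₀ F₁ E₀ E₁ h₀ h₁ x hx hF hE =>
    exact .delim F₁ F₀ E₁ E₀ h₁ h₀ x (by simp only [Set.mem_union] at hx ⊢; tauto) hF hE
  | pure _ _ h₀ h₁ x hx hE => exact .pure _ _ h₁ h₀ x (by rwa [Set.union_comm]) hE

theorem RNF.flip {R : Tm → Tm → Prop} {t u : Tm} (h : RNF R t u) : RNF (flip R) u t := by
  induction h with
  | value v₀ v₁ x hx h => exact .value v₁ v₀ x (by rwa [Set.union_comm]) h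
  | control E₀ E₁ h₀ h₁ k t₀ t₁ k' x hk' hx hxk' h =>
    exact .control E₁ E₀ h₁ h₀ k t₁ t₀ k' x (by simp only [Set.mem_union] at hk' ⊢; tauto)
      (by simp only [Set.mem_union] at hx ⊢; tauto) hxk' h
  | openStuck F₀ F₁ x v₀ v₁ hF _ ih => exact .openStuck F₁ F₀ x v₁ v₀ hF.flip ih

theorem RNF.control_inst {R : Tm → Tm → Prop} {E₀ E₁ : EvalCtx} (h₀ : E₀.IsPure) (h₁ : E₁.IsPure)
    {b₀ b₁ : Tm} {k' : ℕ} (hk' : k' ∉ E₀.fv ∪ E₁.fv ∪ (Tm.shift b₀).fv ∪ (Tm.shift b₁).fv)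
    (h : R (.reset (b₀.inst (EvalCtx.appR (.var k') E₀).cont.toTm))
      (.reset (b₁.inst (EvalCtx.appR (.var k') E₁).cont.toTm))) :
    RNF R (E₀.fill (.shift b₀)) (E₁.fill (.shift b₁)) := by
  have hfin : (E₀.fv ∪ E₁.fv ∪ (Tm.shift b₀).fv ∪ (Tm.shift b₁).fv).Finite :=
    ((E₀.fv_finite.union E₁.fv_finite).union (fv_finite _)).union (fv_finite _)
  obtain ⟨k, hk⟩ := (hfin.insert k').exists_notMem
  obtain ⟨x, hx⟩ := ((hfin.insert k').insert k).exists_notMem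
  obtain ⟨hkk', hk⟩ := not_or.1 hk
  obtain ⟨hxk, hx⟩ := not_or.1 hx
  obtain ⟨hxk', hx⟩ := not_or.1 hx
  have notMem_inst {n : ℕ} (hn : n ∉ E₀.fv ∪ E₁.fv ∪ (Tm.shift b₀).fv ∪ (Tm.shift b₁).fv)
      (hnk : n ≠ k) : n ∉ E₀.fv ∪ E₁.fv ∪ (b₀.inst (.var k)).fv ∪ (b₁.inst (.var k)).fv := by
    simp only [Set.mem_union, not_or] at hn ⊢
    exact ⟨⟨hn.1.1, fun h ↦ (fv_inst_var_subset b₀ k h).elim hnk hn.1.2⟩,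
      fun h ↦ (fv_inst_var_subset b₁ k h).elim hnk hn.2⟩
  have hk_body := notMem_inst hk' (Ne.symm hkk')
  have hx_body := notMem_inst hx hxk
  simp only [Set.mem_union, not_or] at hk hx
  have Shift_inst {b : Tm} (hb : k ∉ (Tm.shift b).fv) : Shift k (b.inst (.var k)) = .shift b :=
    congrArg Tm.shift (abstr_inst_var hb)
  rw [← Shift_inst hk.1.2, ← Shift_inst hk.2]
  refine .control E₀ E₁ h₀ h₁ k _ _ k' x hk_body hx_body hxk' ?_
  rwa [EvalCtx.Lam_reset_app_var_fill_var hx.1.1.1 hxk', inst_var_subst hk.1.2,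
    EvalCtx.Lam_reset_app_var_fill_var hx.1.1.2 hxk', inst_var_subst hk.2]

theorem IsRefinedSimulation.isRefinedBisimulation {R : Tm → Tm → Prop}
    (hR : IsRefinedSimulation R)
    (hconv : ∀ ⦃s t t' : Tm⦄, R s t → Eval t t' → ∃ s', Eval s s') :
    IsRefinedBisimulation R := by
  refine ⟨hR, fun t s t' hst ht ↦ ?_⟩
  obtain ⟨s', hs⟩ := hconv hst ht
  obtain ⟨u, hu, hsu⟩ := hR s t s' hst hs
  obtain rfl : u = t' := ht.unique hu
  exact ⟨s', hs, hsu.flip⟩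

theorem IsRefinedBisimulation.rbisim_of_rnf {R : Tm → Tm → Prop} (hR : IsRefinedBisimulation R)
    {t₀ t₁ : Tm} (h₀ : IsNormal t₀) (h₁ : IsNormal t₁) (h : RNF R t₀ t₁) : RBisim t₀ t₁ := by
  let S : Tm → Tm → Prop := fun s t ↦ (s = t₀ ∧ t = t₁) ∨ R s t
  have hRS : R ≤ S := fun _ _ ↦ Or.inr
  refine ⟨S, ⟨?_, ?_⟩, .inl ⟨rfl, rfl⟩⟩
  · rintro s t s' (⟨rfl, rfl⟩ | hst) hs
    · exact ⟨t, h₁.eval, h₀.eq_of_eval hs ▸ h.mono hRS⟩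
    · obtain ⟨t', ht, hst'⟩ := hR.1 s t s' hst hs
      exact ⟨t', ht, hst'.mono hRS⟩
  · rintro t s t' (⟨rfl, rfl⟩ | hst) ht
    · exact ⟨s, h₀.eval, h₁.eq_of_eval ht ▸ (h.mono hRS).flip⟩
    · obtain ⟨s', hs, hst'⟩ := hR.2 t s t' hst ht
      exact ⟨s', hs, hst'.mono fun _ _ ↦ Or.inr⟩

/-- `EtaRel` up to reduction on the right. The reduction erases the additional reset that an
`EtaDecompRel.etaStuck` pair has around its hole, once a variable is put there. -/
def EtaRedRel (k : ℕ) (t t' : Tm) : Prop :=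
  ∃ u, Relation.ReflTransGen Red t' u ∧ EtaRel k t u

theorem EtaRel.etaRedRel {k : ℕ} {t t' : Tm} (h : EtaRel k t t') : EtaRedRel k t t' :=
  ⟨t', .refl, h⟩

theorem EtaRel.rnf_toTm {k : ℕ} {v v' : Value} (h : EtaRel k v.toTm v'.toTm) :
    RNF (EtaRedRel k) v.toTm v'.toTm := by
  obtain ⟨x, hx⟩ := (v.toTm.fv_finite.union v'.toTm.fv_finite).exists_notMem
  exact .value v v' x hx (h.appVal x).etaRedRel

theorem EtaCtxRel.ctxRel {k : ℕ} {F F' : EvalCtx} (h : EtaCtxRel k F F') :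
    CtxRel (EtaRedRel k) F F' := by
  rcases h.isPure_or_exists_comp_reset with
    ⟨hF, hF'⟩ | ⟨G, G', E, E', rfl, rfl, hE, hE', hG, hR⟩
  · obtain ⟨x, hx⟩ := (F.fv_finite.union F'.fv_finite).exists_notMem
    exact .pure F F' hF hF' x hx (h.fill (.var k x)).etaRedRel
  · obtain ⟨x, hx⟩ := (((G.fv_finite.union G'.fv_finite).union E.fv_finite).union
      E'.fv_finite).exists_notMem
    exact .delim G G' E E' hE hE' x hx (hG.fill (.var k x)).etaRedRel
      (hR.fill (.var k x)).etaRedRel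

theorem EtaCtxRel.ctxRel_comp_reset {k : ℕ} {F F' : EvalCtx} (h : EtaCtxRel k F F') :
    CtxRel (EtaRedRel k) (F.comp (.reset .hole))
      ((F'.comp (.reset .hole)).comp (.reset .hole)) := by
  obtain ⟨x, hx⟩ := (((F.fv_finite.union (F'.comp (.reset .hole)).fv_finite).union
    EvalCtx.hole.fv_finite).union EvalCtx.hole.fv_finite).exists_notMem
  have hred : Red ((F'.comp (.reset .hole)).fill (.var x)) (F'.fill (.var x)) := by
    rw [EvalCtx.fill_comp]
    exact .reset F' (.var x)
  exact .delim _ _ _ _ trivial trivial x hx ⟨_, .single hred, h.fill (.var k x)⟩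
    (EtaRel.refl k _).etaRedRel

theorem EtaCtxRel.rnf_fill_shift {k : ℕ} {E E' : EvalCtx} {b b' : Tm} (h : EtaCtxRel k E E')
    (hE : E.IsPure) (hE' : E'.IsPure) (hb : EtaRel (k + 1) b b') :
    RNF (EtaRedRel k) (E.fill (.shift b)) (E'.fill (.shift b')) := by
  obtain ⟨j, hj⟩ := (((E.fv_finite.union E'.fv_finite).union (fv_finite (.shift b))).union
    (fv_finite (.shift b'))).exists_notMem
  have hcont : EtaRel k (EvalCtx.appR (.var j) E).cont.toTm (EvalCtx.appR (.var j) E').cont.toTm :=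
    (EtaCtxRel.appR (v := .var j) (v' := .var j) (.var k j) h).cont
  exact .control_inst hE hE' hj (EtaRel.reset (hb.inst hcont)).etaRedRel

theorem EtaRel.exists_eval_rnf_of_isNormal {k : ℕ} {s t : Tm} (h : EtaRel k s t)
    (hs : IsNormal s) : ∃ t', Eval t t' ∧ RNF (EtaRedRel k) s t' := by
  have hst := h.decomp
  have s_decomp := s.hasDecomp
  have t_decomp := t.hasDecomp
  generalize s.decomp = d at hst s_decomp
  generalize t.decomp = e at hst t_decomp
  cases hst with
  | value hv =>
    cases s_decomp; cases t_decomp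
    exact ⟨_, (isNormal_toTm _).eval, hv.rnf_toTm⟩
  | openStuck x hF hv =>
    cases s_decomp; cases t_decomp
    exact ⟨_, (isNormal_fill_app_var _ _ _).eval, .openStuck _ _ _ _ _ hF.ctxRel hv.rnf_toTm⟩
  | controlStuck hE hb =>
    cases s_decomp with | controlStuck pure_E
    cases t_decomp with | controlStuck pure_E'
    exact ⟨_, (isNormal_fill_shift pure_E' _).eval, hE.rnf_fill_shift pure_E pure_E' hb⟩
  | step _ =>
    cases s_decomp with | step hred
    exact absurd hred (hs _)
  | @etaStuck F F' v v' hF hv =>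
    cases s_decomp
    cases t_decomp with | step hred
    have fill_reset_reset : F'.fill (.reset (.reset (.app (.var k) v'.toTm))) =
        ((F'.comp (.reset .hole)).comp (.reset .hole)).fill (.app (.var k) v'.toTm) := by
      simp only [EvalCtx.fill_comp, EvalCtx.fill]
    rw [fill_reset_reset] at hred
    exact ⟨_, .of_reds (.single hred) (isNormal_fill_app_var _ _ _).eval,
      .openStuck _ _ _ _ _ hF.ctxRel_comp_reset hv.rnf_toTm⟩

theorem EtaRel.exists_red {k : ℕ} {s s' t : Tm} (h : EtaRel k s t) (hs : Red s s') :
    ∃ t', Red t t' ∧ EtaRel k s' t' := by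
  have hst := h.decomp
  have t_decomp := t.hasDecomp
  rw [(HasDecomp.step hs).decomp_eq] at hst
  generalize t.decomp = e at hst t_decomp
  cases hst with
  | step h =>
    cases t_decomp with | step ht
    exact ⟨_, ht, h⟩

theorem EtaRel.exists_reds {k : ℕ} {s s' t : Tm} (h : EtaRel k s t)
    (hs : Relation.ReflTransGen Red s s') :
    ∃ t', Relation.ReflTransGen Red t t' ∧ EtaRel k s' t' := by
  induction hs with
  | refl => exact ⟨t, .refl, h⟩
  | tail _ hred ih =>
    obtain ⟨u, htu, hu⟩ := ih
    obtain ⟨t', hut, ht'⟩ := hu.exists_red hred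
    exact ⟨t', htu.tail hut, ht'⟩

theorem EtaRel.exists_eval_of_eval {k : ℕ} {s t t' : Tm} (h : EtaRel k s t) (ht : Eval t t') :
    ∃ s', Eval s s' := by
  obtain ⟨hred, hnormal⟩ := ht
  induction hred using Relation.ReflTransGen.head_induction_on generalizing s with
  | refl =>
    refine ⟨s, IsNormal.eval fun u hsu ↦ ?_⟩
    obtain ⟨u', ht, -⟩ := h.exists_red hsu
    exact hnormal u' ht
  | @head t w htw _ ih =>
    by_cases hs : IsNormal s
    · exact ⟨s, hs.eval⟩
    · obtain ⟨u, hsu⟩ := not_forall_not.1 hs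
      obtain ⟨u', htu, hu⟩ := h.exists_red hsu
      obtain rfl : u' = w := Red.rightUnique htu htw
      obtain ⟨s', hs'⟩ := ih hu
      exact ⟨s', .of_reds (.single hsu) hs'⟩

theorem isRefinedSimulation_etaRedRel (k : ℕ) : IsRefinedSimulation (EtaRedRel k) := by
  rintro s t s' ⟨u, htu, hsu⟩ ⟨hs, hnormal⟩
  obtain ⟨w, huw, hw⟩ := hsu.exists_reds hs
  obtain ⟨t', ht', h⟩ := hw.exists_eval_rnf_of_isNormal hnormal
  exact ⟨t', .of_reds (htu.trans huw) ht', h⟩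

theorem isRefinedBisimulation_etaRedRel (k : ℕ) : IsRefinedBisimulation (EtaRedRel k) :=
  (isRefinedSimulation_etaRedRel k).isRefinedBisimulation fun _ _ _ ⟨_, htu, hsu⟩ ht ↦
    hsu.exists_eval_of_eval (ht.of_reds_left htu)

theorem rbisim_shift {E : EvalCtx} {t : Tm} {k k' x : ℕ} (hE : E.IsPure)
    (hk' : k' ∉ E.fv ∪ t.fv) (hx : x ∉ E.fv) (hxk' : x ≠ k') :
    RBisim (E.fill (Shift k t))
      (Shift k' (t.subst k (Lam x (.reset (.app (.var k') (E.fill (.var x))))))) := by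
  obtain ⟨hk'E, hk't⟩ := not_or.1 hk'
  rw [EvalCtx.Lam_reset_app_var_fill_var hx hxk']
  obtain ⟨j, hj⟩ := (((E.fv_finite.union EvalCtx.hole.fv_finite).union
    (Shift k t).fv_finite).union (Shift k' (t.subst k _)).fv_finite).exists_notMem
  refine (isRefinedBisimulation_etaRedRel j).rbisim_of_rnf (isNormal_fill_shift hE _)
    (isNormal_Shift k' _) (RNF.control_inst (E₁ := .hole) hE trivial hj (EtaRel.etaRedRel ?_))
  rw [abstr_inst, abstr_inst, subst_subst_of_notMem hk't]
  change EtaRel j _ (.reset (t.subst k (Tm.subst _ k' (etaReset j).toTm)))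
  rw [EvalCtx.subst_cont_appR_var hk'E]
  exact .reset (.subst_right t k (EtaRel.lam (.eta (.refl ..))))

/-! ### Plain bisimilarity -/

theorem NF.ctxRel_of_fill_shift {R : Tm → Tm → Prop} {E₀ E₁ : EvalCtx} (h₀ : E₀.IsPure)
    (h₁ : E₁.IsPure) {b₀ b₁ : Tm} (h : NF R (E₀.fill (.shift b₀)) (E₁.fill (.shift b₁))) :
    CtxRel R E₀ E₁ := by
  have hd₀ := HasDecomp.controlStuck h₀ b₀
  have hd₁ := HasDecomp.controlStuck h₁ b₁
  generalize E₀.fill (.shift b₀) = s at h hd₀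
  generalize E₁.fill (.shift b₁) = t at h hd₁
  cases h with
  | value v₀ => cases hd₀.unique (.value v₀)
  | openStuck F₀ _ x v₀ => cases hd₀.unique (.openStuck F₀ x v₀)
  | control G₀ G₁ g₀ g₁ k t₀ t₁ hG =>
    cases hd₀.unique (.controlStuck g₀ _)
    cases hd₁.unique (.controlStuck g₁ _)
    exact hG

theorem CtxRel.exists_fill_var_of_isPure {R : Tm → Tm → Prop} {E₀ E₁ : EvalCtx}
    (h : CtxRel R E₀ E₁) (h₀ : E₀.IsPure) : ∃ x, R (E₀.fill (.var x)) (E₁.fill (.var x)) := by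
  cases h with
  | delim F₀ _ E₀ => exact absurd h₀ (EvalCtx.not_isPure_comp_reset F₀ E₀)
  | pure _ _ _ _ x _ hE => exact ⟨x, hE⟩

theorem Bisim.exists_bisim_fill_var {E₀ E₁ : EvalCtx} (h₀ : E₀.IsPure) (h₁ : E₁.IsPure)
    {b₀ b₁ : Tm} (h : Bisim (E₀.fill (.shift b₀)) (E₁.fill (.shift b₁))) :
    ∃ x, Bisim (E₀.fill (.var x)) (E₁.fill (.var x)) := by
  obtain ⟨R, hR, h⟩ := h
  obtain ⟨u, hu, hnf⟩ := hR.1 _ _ _ h (isNormal_fill_shift h₀ b₀).eval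
  rw [(isNormal_fill_shift h₁ b₁).eq_of_eval hu] at hnf
  obtain ⟨x, hx⟩ := (hnf.ctxRel_of_fill_shift h₀ h₁).exists_fill_var_of_isPure h₀
  exact ⟨x, R, hR, hx⟩

theorem Bisim.exists_eval {t u u' : Tm} (h : Bisim t u) (hu : Eval u u') : ∃ t', Eval t t' := by
  obtain ⟨R, hR, h⟩ := h
  obtain ⟨t', ht', -⟩ := hR.2 u t u' h hu
  exact ⟨t', ht'⟩

theorem not_eval_Omega (t : Tm) : ¬ Eval Omega t := by
  have hΩ : Red Omega Omega := Red.beta .hole (.app (.var 0) (.var 0)) (.lam _)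
  rintro ⟨h, hnormal⟩
  have ht : t = Omega := by
    clear hnormal
    induction h with
    | refl => rfl
    | tail _ hred ih => exact Red.rightUnique hred (ih ▸ hΩ)
  exact hnormal Omega (ht ▸ hΩ)

theorem not_bisim_fill_shift (z : ℕ) (b₀ b₁ : Tm) :
    ¬ Bisim ((EvalCtx.appR (.lam (abstr z Omega)) .hole).fill (.shift b₀)) (.shift b₁) := by
  intro h
  obtain ⟨x, hx⟩ := Bisim.exists_bisim_fill_var (E₁ := .hole) (by trivial) trivial h
  obtain ⟨u, hu⟩ := hx.exists_eval (isNormal_toTm (.var x)).eval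
  have hred : Red (.app (.lam (abstr z Omega)) (.var x)) Omega :=
    Red.beta .hole (abstr z Omega) (.var x)
  exact not_eval_Omega u (hu.of_reds_left (.single hred))

end ShiftReset

open ShiftReset Tm in
/-- The first part is the equivalence for the refined bisimilarity. The second part says that it
fails for the plain bisimilarity when the pure context is `(λz.Ω) □`. -/
theorem propositionp :
    (∀ (E : EvalCtx) (t : Tm) (k k' x : ℕ), E.IsPure →
      k' ∉ E.fv ∪ t.fv → x ∉ E.fv → x ≠ k' →
      RBisim (E.fill (Shift k t))
        (Shift k' (t.subst k (Lam x (.reset (.app (.var k') (E.fill (.var x)))))))) ∧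
    (∀ (E : EvalCtx) (t : Tm) (k k' x z : ℕ),
      E = .appR (.lam (abstr z Omega)) .hole →
      k' ∉ E.fv ∪ t.fv → x ∉ E.fv → x ≠ k' →
      ¬ Bisim (E.fill (Shift k t))
        (Shift k' (t.subst k (Lam x (.reset (.app (.var k') (E.fill (.var x)))))))) := by
  refine ⟨fun E t k k' x hE hk' hx hxk' ↦ rbisim_shift hE hk' hx hxk', ?_⟩
  rintro E t k k' x z rfl - - -
  exact not_bisim_fill_shift z _ _
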